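/- Let $I$ be a real compact interval, let $f : I \to I$ be continuous, and let $f^n$ denote the $n$-th iterate of $f$. For $\delta > 0$, a $\delta$-scrambled set of $f$ is an uncountable set $S \subset I$ such that (i) for any $x \ne y$ in $S$, $\limsup_{n \to \infty} |f^n(x) - f^n(y)| \ge \delta$ and $\liminf_{n \to \infty} |f^n(x) - f^n(y)| = 0$; and (ii) for any $x$ in $S$ and any periodic point $p$ of $f$, $\limsup_{n \to \infty} |f^n(x) - f^n(p)| \ge \delta/2$. Let $\omega(x, f)$ denote the set of limit points of the sequence $(f^n(x))_{n \ge 0}$ (that is, the limits of its subsequences); the recurrent set of $f$ is $\{x \in I : x \in \omega(x, f)\}$. A set $S$ is invariant under a map $g$ if $g(S) \subset S$. Theorem 5. Suppose that $f$ has a periodic point of least period $2^k \cdot m$, where $m \ge 3$ is odd and $k \ge 0$. Then for $n = 2$ and for every $n \ge m$ there exist a number $\delta_n > 0$ and an uncountable $\delta_n$-scrambled set $S_n$ of $f$ which is contained in the recurrent set of $f$ and invariant under $f^{2^k \cdot n}$, such that $\bigcap_{x \in S_n} \omega(x, f)$ contains $S_n$ and contains periodic points of $f$ of arbitrarily large least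 periods. -/

import Mathlib

/-- The `ω`-limit set `ω(x, f)` of the point `x` under iteration of `f`. -/
def omegaLimitPt {X : Type*} [TopologicalSpace X] (f : X → X) (x : X) : Set X :=
  omegaLimit Filter.atTop (fun (n : ℕ) (y : X) => f^[n] y) {x}

/-- The set of recurrent points of `f`, i.e. of the points `x` with `x ∈ ω(x, f)`. -/
def recurrentSet {X : Type*} [TopologicalSpace X] (f : X → X) : Set X :=
  {x | x ∈ omegaLimitPt f x}

/-- `S` is a `δ`-scrambled set of the self-map `f` of the compact interval `[a, b]`.
The sequences below take values in `[0, b - a]`, so that `limsup` and `liminf` in `ℝ` are the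
genuine ones. -/
structure IsScrambledSet {a b : ℝ} (f : Set.Icc a b → Set.Icc a b) (δ : ℝ)
    (S : Set (Set.Icc a b)) : Prop where
  uncountable : ¬ S.Countable
  le_limsup : ∀ x ∈ S, ∀ y ∈ S, x ≠ y →
    δ ≤ Filter.limsup (fun n : ℕ => |(f^[n] x : ℝ) - (f^[n] y : ℝ)|) Filter.atTop
  liminf_eq : ∀ x ∈ S, ∀ y ∈ S, x ≠ y →
    Filter.liminf (fun n : ℕ => |(f^[n] x : ℝ) - (f^[n] y : ℝ)|) Filter.atTop = 0
  le_limsup_periodic : ∀ x ∈ S, ∀ p ∈ Function.periodicPts f,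
    δ / 2 ≤ Filter.limsup (fun n : ℕ => |(f^[n] x : ℝ) - (f^[n] p : ℝ)|) Filter.atTop

/-! Extend `f` to the line. Its iterate of order `2^k` has a cycle of odd period `m ≥ 3`; let `h` be
the `n`-th iterate of that map. In the cycle there are neighbouring points `b < b'` that are thrown
across the gap between them. Oddness prevents the whole cycle from alternating between the two
sides, and this forces `h` to fold some interval over itself: by a covering argument for `n ≥ m`
(`hasFold_iterate_of_le`), by a trapping argument for `n = 2` (`hasFold_iterate_two`).

A fold gives an increasing and a decreasing inverse branch of `h` with non-overlapping ranges. Write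
0 for `false` and 1 for `true`. Composed branches attach a cylinder to each 0-1 word and a point to
each 0-1 sequence. Cylinders along a sequence need not shrink to a point, but the exceptional
sequences produce disjoint open sets, so they are countable (`countable_not_shrinks`). The remaining
metric control comes from one fixed point `u` of `h`: the cylinders of `0^n 1` tend to `u`, while
the cylinder of `1` stays at distance `δ` from it.

It remains to choose uncountably many sequences that contain every word, share long runs of 0, and
pairwise show a 1 against the middle of a long run of 0 (`exists_isScrambledFamily`). The scrambled
set consists of the forward `h`-orbits of the points coded by those sequences whose cylinders shrink
(`exists_isChaoticFamily`). -/

namespace IntervalDynamics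

open Set Function Filter Topology

/-! ### Words and scrambled families of 0-1 sequences -/

/-- The word of length `n` read in the sequence `α` from position `t` on. -/
def segment (α : ℕ → Bool) : ℕ → ℕ → List Bool
  | _, 0 => []
  | t, n + 1 => α t :: segment α (t + 1) n

theorem length_segment (α : ℕ → Bool) (t n : ℕ) : (segment α t n).length = n := by
  induction n generalizing t with
  | zero => rfl
  | succ n ih => simp [segment, ih]

theorem segment_add (α : ℕ → Bool) (t n m : ℕ) :
    segment α t (n + m) = segment α t n ++ segment α (t + n) m := by
  induction n generalizing t with
  | zero => simp [segment]
  | succ n ih =>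
    rw [Nat.add_right_comm, segment, segment, ih]
    simp [Nat.add_comm, Nat.add_left_comm]

theorem segment_eq_of_getD {α : ℕ → Bool} {t : ℕ} {w : List Bool}
    (h : ∀ i < w.length, α (t + i) = w.getD i false) : segment α t w.length = w := by
  induction w generalizing t with
  | nil => rfl
  | cons c w ih =>
    rw [List.length_cons, segment, ih]
    · have := h 0 (by simp)
      simpa using this
    · intro i hi
      have := h (i + 1) (by simpa using hi)
      rw [Nat.add_right_comm, Nat.add_assoc]
      simpa using this

theorem segment_congr {α β : ℕ → Bool} {t n : ℕ} (h : ∀ i < n, α (t + i) = β (t + i)) :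
    segment α t n = segment β t n := by
  induction n generalizing t with
  | zero => rfl
  | succ n ih =>
    rw [segment, segment, ih]
    · have := h 0 (by simp)
      simpa using this
    · intro i hi
      have := h (i + 1) (by simpa using hi)
      rwa [Nat.add_right_comm, Nat.add_assoc]

/-- If `α` reads `u ++ w` at `t`, it reads `w` at `t + u.length`. -/
theorem segment_append_right {α : ℕ → Bool} {t : ℕ} {u w : List Bool}
    (h : segment α t (u ++ w).length = u ++ w) : segment α (t + u.length) w.length = w := by
  rw [List.length_append, segment_add] at h
  exact (List.append_inj h (length_segment _ _ _)).2

theorem segment_append_left {α : ℕ → Bool} {t : ℕ} {u w : List Bool}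
    (h : segment α t (u ++ w).length = u ++ w) : segment α t u.length = u := by
  rw [List.length_append, segment_add] at h
  exact (List.append_inj h (length_segment _ _ _)).1

/-- The concatenation of the blocks `B 0 (η 0)`, …, `B (k - 1) (η (k - 1))`. -/
def blockPrefix (B : ℕ → Bool → List Bool) (η : ℕ → Bool) : ℕ → List Bool
  | 0 => []
  | k + 1 => blockPrefix B η k ++ B k (η k)

theorem blockPrefix_prefix (B : ℕ → Bool → List Bool) (η : ℕ → Bool) {j k : ℕ} (h : j ≤ k) :
    blockPrefix B η j <+: blockPrefix B η k := by
  induction k, h using Nat.le_induction with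
  | base => exact List.prefix_rfl
  | succ k _ ih => exact ih.trans (List.prefix_append _ _)

/-- Concatenation of blocks: there are starting positions, independent of the choices `η`, at
which the concatenated sequence reads the chosen blocks. -/
theorem exists_concat_blocks (B : ℕ → Bool → List Bool)
    (hlen : ∀ k, (B k true).length = (B k false).length) (hpos : ∀ k c, B k c ≠ []) :
    ∃ (A : (ℕ → Bool) → ℕ → Bool) (s : ℕ → ℕ), (∀ k, k ≤ s k) ∧
      ∀ η k, segment (A η) (s k) (B k (η k)).length = B k (η k) := by
  have hlen' : ∀ k c, (B k c).length = (B k false).length := by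
    intro k c; cases c
    · rfl
    · exact hlen k
  have hP : ∀ η k, (blockPrefix B η k).length = (blockPrefix B (fun _ => false) k).length := by
    intro η k
    induction k with
    | zero => rfl
    | succ k ih => simp only [blockPrefix, List.length_append, ih, hlen' k (η k)]
  have hge : ∀ η k, k ≤ (blockPrefix B η k).length := by
    intro η k
    induction k with
    | zero => exact Nat.zero_le _
    | succ k ih =>
      have := List.length_pos_of_ne_nil (hpos k (η k))
      simp only [blockPrefix, List.length_append]
      omega
  -- Blocks are nonempty, so `p + 1` of them have a letter at position `p`, and the default of
  -- `getD` is never read. Block lengths do not depend on the choices, hence neither do the starting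
  -- positions.
  refine ⟨fun η p => (blockPrefix B η (p + 1)).getD p false,
    fun k => (blockPrefix B (fun _ => false) k).length, fun k => hge _ k, fun η k => ?_⟩
  have key : ∀ p j, p < (blockPrefix B η j).length →
      (blockPrefix B η (p + 1)).getD p false = (blockPrefix B η j).getD p false := by
    intro p j hp
    have hp' : p < (blockPrefix B η (p + 1)).length := hge η (p + 1)
    rcases le_total (p + 1) j with h | h
    · obtain ⟨r, hr⟩ := blockPrefix_prefix B η h
      rw [← hr, List.getD_append _ _ _ _ hp']
    · obtain ⟨r, hr⟩ := blockPrefix_prefix B η h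
      rw [← hr, List.getD_append _ _ _ _ hp]
  apply segment_eq_of_getD
  intro i hi
  show (blockPrefix B η (_ + 1)).getD _ false = _
  beta_reduce
  rw [key _ (k + 1), ← hP η k, blockPrefix, List.getD_append_right _ _ _ _ (by omega)]
  · simp
  · rw [← hP η k]
    simp only [blockPrefix, List.length_append]
    omega

/-- The blocks used for the scrambled family: each block starts with a prescribed word, so that
all words occur, and goes on with a free letter `c` between long runs of `false`. -/
def scrambleBlock (k : ℕ) (c : Bool) : List Bool :=
  ((Encodable.decode k : Option (List Bool)).getD []) ++
    (List.replicate k false ++ c :: (List.replicate k false ++ [true]))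

/-- The family of sequences `A` is pairwise synchronised and pairwise separated, and all words
occur in each of its members. -/
structure IsScrambledFamily (A : (ℕ → Bool) → ℕ → Bool) : Prop where
  occurs : ∀ η w M, ∃ t, M ≤ t ∧ segment (A η) t w.length = w
  synchronised : ∀ η η' M, ∃ k t, M ≤ k ∧ M ≤ t ∧ ∀ ζ ∈ ({η, η'} : Set (ℕ → Bool)),
    segment (A ζ) t (k + 1) = List.replicate k false ++ [true]
  separated : ∀ η η', η ≠ η' → ∃ ζ ζ', ((ζ = η ∧ ζ' = η') ∨ (ζ = η' ∧ ζ' = η)) ∧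
    ∀ M, ∃ k t, M ≤ k ∧ M ≤ t ∧ segment (A ζ) (t + k) 1 = [true] ∧
      segment (A ζ') t (2 * k + 1 + 1) = List.replicate (2 * k + 1) false ++ [true]

theorem IsScrambledFamily.injective {A : (ℕ → Bool) → ℕ → Bool} (h : IsScrambledFamily A) :
    Injective A := by
  intro η η' hA
  by_contra hne
  obtain ⟨ζ, ζ', hζ, H⟩ := h.separated η η' hne
  have hAζ : A ζ = A ζ' := by rcases hζ with ⟨rfl, rfl⟩ | ⟨rfl, rfl⟩ <;> simp [hA]
  obtain ⟨k, t, -, -, e1, e2⟩ := H 0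
  rw [show 2 * k + 1 = k + (1 + k) by ring, List.replicate_add, List.append_assoc,
    List.replicate_add, List.append_assoc] at e2
  have e3 := segment_append_left (segment_append_right (α := A ζ') (t := t)
    (u := List.replicate k false)
    (w := List.replicate 1 false ++ (List.replicate k false ++ [true]))
    (by rw [← e2]; simp [length_segment]))
  rw [hAζ] at e1
  simp [e1] at e3

/-- The free letter of block `k` is `η` at the first component of `Nat.unpair k`, so each coordinate
of `η` controls infinitely many blocks. Where `η` and `η'` differ, the blocks read `0^k 1 0^k 1` and
`0^(2k+1) 1`. The tail `0^k 1` is common to all members. -/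
theorem exists_isScrambledFamily : ∃ A, IsScrambledFamily A := by
  obtain ⟨A, s, hs, hA⟩ := exists_concat_blocks scrambleBlock
    (by intro k; simp [scrambleBlock]) (by intro k c; simp [scrambleBlock])
  refine ⟨fun η => A (fun k => η (Nat.unpair k).1), ?_, ?_, ?_⟩
  · intro η w M
    set ξ : ℕ → Bool := fun k => η (Nat.unpair k).1
    -- Padding `w` with `M` zeros makes it occur at a position at least `M`.
    have h := hA ξ (Encodable.encode (List.replicate M false ++ w))
    rw [scrambleBlock] at h
    simp only [Encodable.encodek, Option.getD_some] at h
    have h2 := segment_append_right (segment_append_left h)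
    exact ⟨_, by simp, h2⟩
  · intro η η' M
    refine ⟨M, s M + ((Encodable.decode M : Option (List Bool)).getD []).length + (M + 1), le_rfl,
      by omega, ?_⟩
    intro ζ _
    have h := hA (fun k => ζ (Nat.unpair k).1) M
    rw [scrambleBlock] at h
    have h2 := segment_append_right h
    rw [List.append_cons] at h2
    have h3 := segment_append_right h2
    simpa using h3
  · intro η η' hne
    obtain ⟨i, hi⟩ := Function.ne_iff.1 hne
    have main : ∀ ζ ζ' : ℕ → Bool, ζ i = true → ζ' i = false → ∀ M, ∃ k t, M ≤ k ∧ M ≤ t ∧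
        segment (A (fun k => ζ (Nat.unpair k).1)) (t + k) 1 = [true] ∧
        segment (A (fun k => ζ' (Nat.unpair k).1)) t (2 * k + 1 + 1)
          = List.replicate (2 * k + 1) false ++ [true] := by
      intro ζ ζ' h1 h0 M
      set k := Nat.pair i M with hk
      have hkM : M ≤ k := Nat.right_le_pair i M
      have hsk := hs k
      refine ⟨k, s k + ((Encodable.decode k : Option (List Bool)).getD []).length, hkM, by omega,
        ?_, ?_⟩
      · have h := hA (fun k => ζ (Nat.unpair k).1) k
        rw [scrambleBlock] at h
        have h2 := segment_append_right (segment_append_right h)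
        have h3 := segment_append_left (u := [_]) h2
        simpa [hk, h1] using h3
      · have h := hA (fun k => ζ' (Nat.unpair k).1) k
        rw [scrambleBlock] at h
        have h2 := segment_append_right h
        have e : ζ' (Nat.unpair k).1 = false := by simp [hk, h0]
        rw [e] at h2
        have e2 : List.replicate k false ++ false :: (List.replicate k false ++ [true])
            = List.replicate (2 * k + 1) false ++ [true] := by
          rw [show 2 * k + 1 = k + (k + 1) by ring, List.replicate_add, List.replicate_succ]
          simp
        rw [e2] at h2
        simpa using h2
    cases h : η i
    · have h' : η' i = true := by
        cases h' : η' i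
        · exact absurd (h.trans h'.symm) hi
        · rfl
      exact ⟨η', η, Or.inr ⟨rfl, rfl⟩, main η' η h' h⟩
    · have h' : η' i = false := by
        cases h' : η' i
        · rfl
        · exact absurd (h.trans h'.symm) hi
      exact ⟨η, η', Or.inl ⟨rfl, rfl⟩, main η η' h h'⟩

/-! ### Folds from a cycle of odd period -/

/-- `h` folds the interval `[a, b]` over itself: at three consecutive points of the interval its
values lie alternately on the two sides of the interval. -/
def HasFold (h : ℝ → ℝ) : Prop :=
  ∃ a b x y z : ℝ, a ≤ x ∧ x < y ∧ y < z ∧ z ≤ b ∧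
    ((b ≤ h x ∧ h y ≤ a ∧ b ≤ h z) ∨ (h x ≤ a ∧ b ≤ h y ∧ h z ≤ a))

theorem subset_image_iterate {f : ℝ → ℝ} {I : Set ℝ} (h : I ⊆ f '' I) (n : ℕ) :
    I ⊆ f^[n] '' I := by
  induction n with
  | zero => simp
  | succ n ih =>
    rw [iterate_succ, image_comp]
    exact ih.trans (image_mono h)

/-- A cycle of period at least `2` has two neighbouring points `b < b'`, of which `b` is the last
point that moves to the right. -/
theorem exists_central_pair {f : ℝ → ℝ} {m : ℕ} (hm : 2 ≤ m) {c : ℝ} (hc : minimalPeriod f c = m) :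
    ∃ b b', b < b' ∧ minimalPeriod f b = m ∧ b' ≤ f b ∧ f b' ≤ b ∧
      (∀ i, f^[i] b ≤ b ∨ b' ≤ f^[i] b) ∧ (∀ i, b' ≤ f^[i] b → f (f^[i] b) < f^[i] b) := by
  classical
  have hcp : c ∈ periodicPts f := minimalPeriod_pos_iff_mem_periodicPts.1 (by omega)
  have hper : ∀ i, minimalPeriod f (f^[i] c) = m := fun i => by
    rw [minimalPeriod_apply_iterate hcp, hc]
  have hne : ∀ i, f (f^[i] c) ≠ f^[i] c := by
    intro i h
    have h1 := minimalPeriod_eq_one_iff_isFixedPt.2 h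
    rw [hper] at h1
    omega
  set P : Finset ℝ := (Finset.range m).image (fun i => f^[i] c) with hP
  have hmem : ∀ i, f^[i] c ∈ P := by
    intro i
    rw [← iterate_mod_minimalPeriod_eq, hc]
    exact Finset.mem_image.2 ⟨i % m, Finset.mem_range.2 (Nat.mod_lt _ (by omega)), rfl⟩
  have hmem' : ∀ x ∈ P, ∃ i, x = f^[i] c := by
    intro x hx
    obtain ⟨i, _, rfl⟩ := Finset.mem_image.1 hx
    exact ⟨i, rfl⟩
  have hfP : ∀ x ∈ P, f x ∈ P := by
    intro x hx
    obtain ⟨i, rfl⟩ := hmem' x hx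
    rw [← iterate_succ_apply' f]; exact hmem _
  have hPne : P.Nonempty := ⟨_, hmem 0⟩
  have hQne : (P.filter (fun x => x < f x)).Nonempty := by
    refine ⟨P.min' hPne, Finset.mem_filter.2 ⟨P.min'_mem _, ?_⟩⟩
    obtain ⟨i, hi⟩ := hmem' _ (P.min'_mem hPne)
    refine lt_of_le_of_ne (P.min'_le _ (hfP _ (P.min'_mem _))) ?_
    rw [hi]; exact (hne i).symm
  obtain ⟨b, hbQ, hbmax⟩ : ∃ b ∈ P.filter (fun x => x < f x),
      ∀ x ∈ P.filter (fun x => x < f x), x ≤ b :=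
    ⟨_, Finset.max'_mem _ hQne, fun x hx => Finset.le_max' _ x hx⟩
  obtain ⟨hbP, hbf⟩ := Finset.mem_filter.1 hbQ
  have hRne : (P.filter (fun x => b < x)).Nonempty := ⟨f b, Finset.mem_filter.2 ⟨hfP b hbP, hbf⟩⟩
  obtain ⟨b', hbR, hbmin⟩ : ∃ b' ∈ P.filter (fun x => b < x),
      ∀ x ∈ P.filter (fun x => b < x), b' ≤ x :=
    ⟨_, Finset.min'_mem _ hRne, fun x hx => Finset.min'_le _ x hx⟩
  obtain ⟨hbP', hbb'⟩ := Finset.mem_filter.1 hbR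
  have hdich : ∀ x ∈ P, x ≤ b ∨ b' ≤ x := by
    intro x hx
    rcases le_or_gt x b with h | h
    · exact Or.inl h
    · exact Or.inr (hbmin x (Finset.mem_filter.2 ⟨hx, h⟩))
  have hdec : ∀ x ∈ P, b' ≤ x → f x < x := by
    intro x hx hbx
    obtain ⟨i, hi⟩ := hmem' x hx
    refine lt_of_le_of_ne (not_lt.1 fun h => ?_) (by rw [hi]; exact hne i)
    have := hbmax x (Finset.mem_filter.2 ⟨hx, h⟩)
    linarith
  obtain ⟨i0, hi0⟩ := hmem' b hbP
  have horb : ∀ i, f^[i] b ∈ P := by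
    intro i
    rw [hi0, ← iterate_add_apply]; exact hmem _
  refine ⟨b, b', hbb', by rw [hi0, hper], hbmin _ (Finset.mem_filter.2 ⟨hfP b hbP, hbf⟩), ?_,
    fun i => hdich _ (horb i), fun i => hdec _ (horb i)⟩
  rcases hdich _ (hfP b' hbP') with h | h
  · exact h
  · exact absurd (hdec b' hbP' le_rfl) (not_lt.2 h)

/-- On a cycle of odd period some point stays on its side of the central pair. -/
theorem exists_same_side {f : ℝ → ℝ} {m : ℕ} (hodd : Odd m) {b b' : ℝ} (hbb' : b < b')
    (hb : minimalPeriod f b = m) (hdich : ∀ i, f^[i] b ≤ b ∨ b' ≤ f^[i] b) :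
    ∃ i, (f^[i] b ≤ b ∧ f^[i + 1] b ≤ b) ∨ (b' ≤ f^[i] b ∧ b' ≤ f^[i + 1] b) := by
  by_contra! hcon
  have h1 : ∀ i, f^[i] b ≤ b → b' ≤ f^[i + 1] b := fun i hi =>
    (hdich (i + 1)).resolve_left (not_le.2 ((hcon i).1 hi))
  have h2 : ∀ i, b' ≤ f^[i] b → f^[i + 1] b ≤ b := fun i hi =>
    (hdich (i + 1)).resolve_right (not_le.2 ((hcon i).2 hi))
  -- If sides alternate, even times are on the left, and the odd time `m`, which returns to `b`,
  -- would be on the right.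
  have h3 : ∀ i, f^[2 * i] b ≤ b := by
    intro i
    induction i with
    | zero => simp
    | succ i ih => exact h2 _ (h1 _ ih)
  obtain ⟨r, hr⟩ := hodd
  have h4 := h1 _ (h3 r)
  rw [← hr, ← hb, iterate_minimalPeriod] at h4
  linarith

/-- Since `[b, b']` covers itself under `f`, the values `b`, `b'` and a cycle point `w` that stays
on its side are all taken by `f^[l]` in `[b, b']`, where `l = n - 1`. Between a point with value `w`
and one with the endpoint value on the other side, the nearer endpoint is also taken. One more
application of `f` throws both endpoints across but leaves `w` on its side: a fold. -/
theorem hasFold_iterate_of_le {f : ℝ → ℝ} (hf : Continuous f) {m n : ℕ} (hm : 2 ≤ m)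
    (hodd : Odd m) {c : ℝ} (hc : minimalPeriod f c = m) (hn : m ≤ n) : HasFold f^[n] := by
  obtain ⟨b, b', hbb', hb, hfb, hfb', hdich, hdec⟩ := exists_central_pair hm hc
  obtain ⟨i, hi⟩ := exists_same_side hodd hbb' hb hdich
  obtain ⟨l, rfl⟩ : ∃ l, n = l + 1 := ⟨n - 1, by omega⟩
  have hcov : Icc b b' ⊆ f '' Icc b b' := by
    intro x hx
    exact intermediate_value_Icc' hbb'.le hf.continuousOn ⟨hfb'.trans hx.1, hx.2.trans hfb⟩
  have hfib : ∃ w, f^[i] b = w ∧ ∃ x ∈ Icc b b', f^[l] x = w := by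
    refine ⟨_, rfl, ?_⟩
    -- Here `n ≥ m` enters: `i % m ≤ l`, so `l - i % m` steps can be spent on reaching `b` from
    -- inside `[b, b']`.
    rw [← iterate_mod_minimalPeriod_eq, hb]
    have hlt : i % m < m := Nat.mod_lt _ (by omega)
    obtain ⟨y, hy, hyb⟩ := subset_image_iterate hcov (l - i % m) (left_mem_Icc.2 hbb'.le)
    refine ⟨y, hy, ?_⟩
    rw [← hyb, ← iterate_add_apply]
    congr 1; omega
  obtain ⟨w, hw, x, hx, hxw⟩ := hfib
  obtain ⟨y, hy, hyb⟩ := subset_image_iterate hcov l (left_mem_Icc.2 hbb'.le)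
  obtain ⟨y', hy', hyb'⟩ := subset_image_iterate hcov l (right_mem_Icc.2 hbb'.le)
  have hl : Continuous f^[l] := hf.iterate l
  rw [iterate_succ_apply', hw] at hi
  have hval : ∀ s, f^[l + 1] s = f (f^[l] s) := fun s => iterate_succ_apply' f l s
  rcases hi with ⟨h1, h2⟩ | ⟨h1, h2⟩
  · have hwb : w < b := lt_of_le_of_ne h1 (by rintro rfl; linarith)
    obtain ⟨t, ht, htb⟩ : ∃ t ∈ uIcc x y', f^[l] t = b := by
      have := intermediate_value_uIcc (a := x) (b := y') hl.continuousOn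
      rw [hxw, hyb', uIcc_of_le (by linarith)] at this
      exact this ⟨hwb.le, hbb'.le⟩
    have htx : t ≠ x := by rintro rfl; linarith
    have hty : t ≠ y' := by rintro rfl; linarith
    rcases le_total x y' with h | h
    · rw [uIcc_of_le h] at ht
      exact ⟨b, b', x, t, y', hx.1, lt_of_le_of_ne ht.1 htx.symm, lt_of_le_of_ne ht.2 hty, hy'.2,
        Or.inr ⟨by rw [hval, hxw]; exact h2, by rw [hval, htb]; exact hfb,
          by rw [hval, hyb']; exact hfb'⟩⟩
    · rw [uIcc_of_ge h] at ht
      exact ⟨b, b', y', t, x, hy'.1, lt_of_le_of_ne ht.1 hty.symm, lt_of_le_of_ne ht.2 htx, hx.2,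
        Or.inr ⟨by rw [hval, hyb']; exact hfb', by rw [hval, htb]; exact hfb,
          by rw [hval, hxw]; exact h2⟩⟩
  · have hwb : b' < w := lt_of_le_of_ne h1 (by rintro rfl; linarith)
    obtain ⟨t, ht, htb⟩ : ∃ t ∈ uIcc y x, f^[l] t = b' := by
      have := intermediate_value_uIcc (a := y) (b := x) hl.continuousOn
      rw [hxw, hyb, uIcc_of_le (by linarith)] at this
      exact this ⟨hbb'.le, hwb.le⟩
    have htx : t ≠ x := by rintro rfl; linarith
    have hty : t ≠ y := by rintro rfl; linarith
    rcases le_total x y with h | h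
    · rw [uIcc_of_ge h] at ht
      exact ⟨b, b', x, t, y, hx.1, lt_of_le_of_ne ht.1 htx.symm, lt_of_le_of_ne ht.2 hty, hy.2,
        Or.inl ⟨by rw [hval, hxw]; exact h2, by rw [hval, htb]; exact hfb',
          by rw [hval, hyb]; exact hfb⟩⟩
    · rw [uIcc_of_le h] at ht
      exact ⟨b, b', y, t, x, hy.1, lt_of_le_of_ne ht.1 hty.symm, lt_of_le_of_ne ht.2 htx, hx.2,
        Or.inl ⟨by rw [hval, hyb]; exact hfb, by rw [hval, htb]; exact hfb',
          by rw [hval, hxw]; exact h2⟩⟩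

/-- From the central pair of a cycle one finds a point `v ≥ b` that jumps over a fixed point `z`
to the right and comes back to the left of `b`. -/
theorem exists_overjump {f : ℝ → ℝ} (hf : Continuous f) {m : ℕ} (hm : 3 ≤ m) {b b' : ℝ}
    (hbb' : b < b') (hb : minimalPeriod f b = m) (hfb : b' ≤ f b) (hfb' : f b' ≤ b)
    (hdich : ∀ i, f^[i] b ≤ b ∨ b' ≤ f^[i] b)
    (hdec : ∀ i, b' ≤ f^[i] b → f (f^[i] b) < f^[i] b) :
    ∃ v z, b ≤ v ∧ v < z ∧ z < b' ∧ f z = z ∧ z < f v ∧ f^[2] v ≤ b ∧ f^[2] v < v := by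
  classical
  obtain ⟨z, hz, hfz⟩ : ∃ z ∈ Icc b b', f z - z = 0 := by
    have := intermediate_value_Icc' (f := fun x => f x - x) hbb'.le
      (hf.sub continuous_id).continuousOn
    exact this ⟨by linarith, by linarith⟩
  have hfz : f z = z := by linarith
  have hzb : z ≠ b := by rintro rfl; linarith
  have hzb' : z ≠ b' := by rintro rfl; linarith
  have hbz : b < z := lt_of_le_of_ne hz.1 hzb.symm
  have hzb'' : z < b' := lt_of_le_of_ne hz.2 hzb'
  -- the first return of `b` to the left side
  have hex : ∃ j, f^[j + 2] b ≤ b := ⟨m - 2, by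
    rw [show m - 2 + 2 = m by omega, ← hb, iterate_minimalPeriod]⟩
  set j := Nat.find hex with hj
  have hjs : f^[j + 2] b ≤ b := Nat.find_spec hex
  have hjm : ∀ i ≤ j, b' ≤ f^[i + 1] b ∧ f^[i + 1] b ≤ f b := by
    intro i hi
    induction i with
    | zero => exact ⟨hfb, le_rfl⟩
    | succ i ih =>
      obtain ⟨h1, h2⟩ := ih (by omega)
      have h3 : b' ≤ f^[i + 1 + 1] b :=
        (hdich _).resolve_left (Nat.find_min hex (m := i) (by omega))
      refine ⟨h3, le_trans ?_ h2⟩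
      rw [iterate_succ_apply' f (i + 1)]
      exact (hdec _ h1).le
  obtain ⟨hq1, hq2⟩ := hjm j le_rfl
  -- The last point before the return lies between `z = f z` and `f b`, because cycle points on the
  -- right move left; so it has a preimage in `[b, z]`.
  obtain ⟨v, hv, hfv⟩ : ∃ v ∈ Icc b z, f v = f^[j + 1] b :=
    intermediate_value_Icc' hbz.le hf.continuousOn ⟨by rw [hfz]; linarith, hq2⟩
  have hf2 : f^[2] v ≤ b := by
    show f (f v) ≤ b
    rw [hfv, ← iterate_succ_apply' f]
    exact hjs
  have hvz : v ≠ z := by rintro rfl; linarith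
  refine ⟨v, z, hv.1, lt_of_le_of_ne hv.2 hvz, hzb'', hfz, by linarith, hf2, ?_⟩
  -- Equality would force `v = b`, giving `b` period at most 2.
  refine lt_of_le_of_ne (hf2.trans hv.1) fun h => ?_
  have hvb : v = b := le_antisymm (h ▸ hf2) hv.1
  rw [hvb] at h
  have := IsPeriodicPt.minimalPeriod_le (f := f) (n := 2) (by norm_num) h
  omega

/-- As `m` is odd, the orbit of `b` under `F = f^[2]` reaches `f b`, which lies to the right of `z`.
So no `F`-invariant set that lies to the left of `z₀ ≤ z`, or in an interval ending at `z₀`, can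
contain `b`. This yields first a point `d` with `F d = z₀`, then a point `e` between `d` and `z₀`
mapped below `d`: a fold over `[d, z₀]`. -/
theorem hasFold_iterate_two {f : ℝ → ℝ} (hf : Continuous f) {m : ℕ} (hm : 3 ≤ m)
    (hodd : Odd m) {c : ℝ} (hc : minimalPeriod f c = m) : HasFold f^[2] := by
  obtain ⟨b, b', hbb', hb, hfb, hfb', hdich, hdec⟩ := exists_central_pair (by omega) hc
  obtain ⟨v, z, hbv, hvz, hzb', hfz, hzfv, hvb, hvv⟩ :=
    exists_overjump hf hm hbb' hb hfb hfb' hdich hdec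
  set F := f^[2] with hF
  have hFc : Continuous F := hf.iterate 2
  have hFz : F z = z := by show f (f z) = z; rw [hfz, hfz]
  obtain ⟨r, hr⟩ := hodd
  have hesc : F^[r + 1] b = f b := by
    rw [hF, ← iterate_mul, show 2 * (r + 1) = 1 + m by omega, iterate_add_apply, ← hb,
      iterate_minimalPeriod]
    rfl
  -- the first fixed point `z₀` of `F` to the right of `v`
  obtain ⟨z₀, ⟨⟨hz₀v, hz₀z⟩, hFz₀⟩, hz₀min⟩ : ∃ z₀, IsLeast (Icc v z ∩ {x | F x = x}) z₀ :=
    (isCompact_Icc.inter_right (isClosed_eq hFc continuous_id)).exists_isLeast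
      ⟨z, ⟨hvz.le, le_rfl⟩, hFz⟩
  have hFz₀ : F z₀ = z₀ := hFz₀
  have hz₀v' : v < z₀ := lt_of_le_of_ne hz₀v (by rintro rfl; linarith)
  have hlow : ∀ x ∈ Ico v z₀, F x < x := by
    intro x hx
    by_contra! hcon
    obtain ⟨t, ht, htf⟩ : ∃ t ∈ Icc v x, F t - t = 0 :=
      intermediate_value_Icc (f := fun x => F x - x) hx.1 (hFc.sub continuous_id).continuousOn
        ⟨by linarith, by linarith⟩
    have := hz₀min ⟨⟨ht.1, by linarith [ht.2, hx.2]⟩, (by show F t = t; linarith)⟩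
    linarith [ht.2, hx.2]
  have hstay : ∀ s : Set ℝ, b ∈ s → MapsTo F s s → f b ∈ s := by
    intro s hbs hs
    rw [← hesc]
    exact hs.iterate (r + 1) hbs
  obtain ⟨x, hxz, hFx⟩ : ∃ x < z₀, z₀ ≤ F x := by
    by_contra! hcon
    have : f b ∈ Iio z₀ := hstay (Iio z₀) (show b < z₀ by linarith) hcon
    have : f b < z₀ := this
    linarith
  have hxv : x < v := by
    by_contra! hcon
    linarith [hlow x ⟨hcon, hxz⟩]
  -- the last point `d` before `v` with `F d = z₀`
  obtain ⟨d, ⟨⟨hxd, hdv⟩, hFd⟩, hdmax⟩ : ∃ d, IsGreatest (Icc x v ∩ {t | F t = z₀}) d := by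
    refine (isCompact_Icc.inter_right (isClosed_eq hFc continuous_const)).exists_isGreatest ?_
    obtain ⟨t, ht, htf⟩ := intermediate_value_Icc' hxv.le hFc.continuousOn
      (show z₀ ∈ Icc (F v) (F x) from ⟨by linarith, hFx⟩)
    exact ⟨t, ht, htf⟩
  have hFd : F d = z₀ := hFd
  have hup : ∀ t ∈ Icc d z₀, F t ≤ z₀ := by
    intro t ht
    rcases lt_or_ge t v with htv | htv
    · by_contra! hcon
      obtain ⟨s, hs, hsf⟩ := intermediate_value_Icc' htv.le hFc.continuousOn
        (show z₀ ∈ Icc (F v) (F t) from ⟨by linarith, hcon.le⟩)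
      have hsd := hdmax ⟨⟨by linarith [hs.1, ht.1], hs.2⟩, hsf⟩
      have : s = t := le_antisymm (hsd.trans ht.1) hs.1
      rw [this] at hsf
      linarith
    · rcases eq_or_lt_of_le ht.2 with h | h
      · rw [h, hFz₀]
      · linarith [hlow t ⟨htv, h⟩]
  obtain ⟨e, he, hFe⟩ : ∃ e ∈ Icc d z₀, F e < d := by
    by_contra! hcon
    rcases lt_or_ge b d with h | h
    -- If `b < d`, then `v` itself is sent below `d`; otherwise `[d, z₀]` would trap the orbit of
    -- `b`.
    · have := hcon v ⟨hdv, hz₀v⟩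
      linarith
    · have := hstay (Icc d z₀) ⟨h, by linarith⟩ (fun t ht => ⟨hcon t ht, hup t ht⟩)
      linarith [this.2]
  have hed : e ≠ d := by rintro rfl; linarith
  have hez : e ≠ z₀ := by rintro rfl; linarith
  exact ⟨d, z₀, d, e, z₀, le_rfl, lt_of_le_of_ne he.1 hed.symm, lt_of_le_of_ne he.2 hez, le_rfl,
    Or.inl ⟨hFd.ge, hFe.le, hFz₀.ge⟩⟩

/-! ### Monotone inverse branches and their limits -/

/-- An increasing lap of a continuous function over `[a, b]` has a strictly increasing right
inverse. -/
theorem exists_strictMonoOn_rightInverse {h : ℝ → ℝ} (hc : Continuous h) {a b x y : ℝ}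
    (hxy : x ≤ y) (hx : h x ≤ a) (hy : b ≤ h y) :
    ∃ φ : ℝ → ℝ, MapsTo φ (Icc a b) (Icc x y) ∧ (∀ w ∈ Icc a b, h (φ w) = w) ∧
      StrictMonoOn φ (Icc a b) := by
  -- Taking the least preimage gives monotonicity: `h` takes each smaller value already before `φ
  -- w'`. The function `φ` may be discontinuous; its values off `[a, b]` are irrelevant.
  have hex : ∀ w, ∃ t, w ∈ Icc a b → IsLeast (Icc x y ∩ {t | h t = w}) t := by
    intro w
    by_cases hw : w ∈ Icc a b
    · obtain ⟨s, hs, hsw⟩ := intermediate_value_Icc hxy hc.continuousOn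
        (show w ∈ Icc (h x) (h y) from ⟨hx.trans hw.1, hw.2.trans hy⟩)
      obtain ⟨t, ht⟩ := (isCompact_Icc.inter_right (isClosed_eq hc continuous_const)).exists_isLeast
        ⟨s, hs, hsw⟩
      exact ⟨t, fun _ => ht⟩
    · exact ⟨0, fun h => absurd h hw⟩
  choose φ hφ using hex
  have hφ' : ∀ w ∈ Icc a b, h (φ w) = w := fun w hw => (hφ w hw).1.2
  refine ⟨φ, fun w hw => (hφ w hw).1.1, hφ', fun w hw w' hw' hlt => ?_⟩
  have h1 := (hφ w' hw').1.1
  obtain ⟨s, hs, hsw⟩ := intermediate_value_Icc h1.1 hc.continuousOn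
    (show w ∈ Icc (h x) (h (φ w')) from ⟨hx.trans hw.1, by rw [hφ' w' hw']; exact hlt.le⟩)
  have h2 : φ w ≤ s := (hφ w hw).2 ⟨⟨hs.1, hs.2.trans h1.2⟩, hsw⟩
  refine lt_of_le_of_ne (h2.trans hs.2) fun he => hlt.ne ?_
  rw [← hφ' w hw, he, hφ' w' hw']

theorem exists_strictAntiOn_rightInverse {h : ℝ → ℝ} (hc : Continuous h) {a b x y : ℝ}
    (hxy : x ≤ y) (hx : b ≤ h x) (hy : h y ≤ a) :
    ∃ φ : ℝ → ℝ, MapsTo φ (Icc a b) (Icc x y) ∧ (∀ w ∈ Icc a b, h (φ w) = w) ∧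
      StrictAntiOn φ (Icc a b) := by
  obtain ⟨φ, h1, h2, h3⟩ := exists_strictMonoOn_rightInverse (h := fun t => -h t) hc.neg
    (a := -b) (b := -a) hxy (neg_le_neg hx) (neg_le_neg hy)
  have hm : ∀ w ∈ Icc a b, -w ∈ Icc (-b) (-a) := fun w hw => ⟨neg_le_neg hw.2, neg_le_neg hw.1⟩
  refine ⟨fun w => φ (-w), fun w hw => h1 (hm w hw), fun w hw => ?_, fun w hw w' hw' hlt => ?_⟩
  · have := h2 _ (hm w hw)
    linarith
  · exact h3 (hm w' hw') (hm w hw) (neg_lt_neg hlt)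

/-- Two inverse branches of `h` over `[a, b]`, an increasing one with index `false` and a
decreasing one with index `true`, whose ranges do not overlap. -/
structure IsBranchPair (h : ℝ → ℝ) (a b : ℝ) (φ : Bool → ℝ → ℝ) : Prop where
  continuous : Continuous h
  lt : a < b
  mapsTo : ∀ c, MapsTo (φ c) (Icc a b) (Icc a b)
  rightInv : ∀ c, ∀ y ∈ Icc a b, h (φ c y) = y
  strictMonoOn : StrictMonoOn (φ false) (Icc a b)
  strictAntiOn : StrictAntiOn (φ true) (Icc a b)
  separated : (∀ x ∈ Icc a b, ∀ y ∈ Icc a b, φ false x ≤ φ true y) ∨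
    (∀ x ∈ Icc a b, ∀ y ∈ Icc a b, φ true y ≤ φ false x)

theorem HasFold.exists_isBranchPair {h : ℝ → ℝ} (hc : Continuous h) (hh : HasFold h) :
    ∃ a b φ, IsBranchPair h a b φ := by
  obtain ⟨a, b, x, y, z, hax, hxy, hyz, hzb, hl⟩ := hh
  have s1 : Icc x y ⊆ Icc a b := Icc_subset_Icc hax (by linarith)
  have s2 : Icc y z ⊆ Icc a b := Icc_subset_Icc (by linarith) hzb
  rcases hl with ⟨h1, h2, h3⟩ | ⟨h1, h2, h3⟩
  · obtain ⟨φ, p1, p2, p3⟩ := exists_strictAntiOn_rightInverse hc hxy.le h1 h2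
    obtain ⟨ψ, q1, q2, q3⟩ := exists_strictMonoOn_rightInverse hc hyz.le h2 h3
    refine ⟨a, b, fun c => bif c then φ else ψ, hc, by linarith, ?_, ?_, q3, p3,
      Or.inr fun u hu v hv => (p1 hv).2.trans (q1 hu).1⟩
    · rintro (_ | _)
      exacts [q1.mono_right s2, p1.mono_right s1]
    · rintro (_ | _)
      exacts [q2, p2]
  · obtain ⟨φ, p1, p2, p3⟩ := exists_strictMonoOn_rightInverse hc hxy.le h1 h2
    obtain ⟨ψ, q1, q2, q3⟩ := exists_strictAntiOn_rightInverse hc hyz.le h2 h3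
    refine ⟨a, b, fun c => bif c then ψ else φ, hc, by linarith, ?_, ?_, p3, q3,
      Or.inl fun u hu v hv => (p1 hu).2.trans (q1 hv).1⟩
    · rintro (_ | _)
      exacts [p1.mono_right s1, q1.mono_right s2]
    · rintro (_ | _)
      exacts [p2, q2]

/-- Iterating an increasing inverse branch `φ` on the range of another branch `ψ` leads to a fixed
point, which stays away from the range of `ψ`. -/
theorem exists_limit_of_branches_right {H φ ψ : ℝ → ℝ} {a b : ℝ} (hH : Continuous H) (hab : a < b)
    (hφ : MapsTo φ (Icc a b) (Icc a b)) (hφH : ∀ y ∈ Icc a b, H (φ y) = y)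
    (hmono : StrictMonoOn φ (Icc a b)) (hψ : MapsTo ψ (Icc a b) (Icc a b))
    (hinj : InjOn ψ (Icc a b)) (hsep : ∀ x ∈ Icc a b, ∀ y ∈ Icc a b, φ x ≤ ψ y) :
    ∃ u, H u = u ∧ (∃ δ > 0, ∀ y ∈ Icc a b, δ ≤ |ψ y - u|) ∧
      ∀ ε > 0, ∃ n₀, ∀ n ≥ n₀, ∀ y ∈ Icc a b, |φ^[n] (ψ y) - u| ≤ ε := by
  have ha : a ∈ Icc a b := left_mem_Icc.2 hab.le
  have hb : b ∈ Icc a b := right_mem_Icc.2 hab.le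
  have hit : ∀ n, MapsTo φ^[n] (Icc a b) (Icc a b) := fun n => hφ.iterate n
  have hmon : ∀ n, MonotoneOn φ^[n] (Icc a b) := by
    intro n
    induction n with
    | zero => exact monotoneOn_id
    | succ n ih =>
      rw [iterate_succ]
      exact ih.comp hmono.monotoneOn hφ
  -- If `φ b = b`, separation pins `ψ` to the constant `b`, against injectivity.
  have hφb : φ b < b := by
    refine lt_of_le_of_ne (hφ hb).2 fun he => hab.ne (hinj ha hb ?_)
    have h1 := hsep b hb a ha
    have h2 := hsep b hb b hb
    rw [he] at h1 h2
    rw [le_antisymm (hψ ha).2 h1, le_antisymm (hψ hb).2 h2]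
  have hanti : Antitone (fun n => φ^[n] b) := by
    refine antitone_nat_of_succ_le fun n => ?_
    rw [iterate_succ_apply]
    exact hmon n (hφ hb) hb hφb.le
  have hbdd : BddBelow (range fun n => φ^[n] b) :=
    ⟨a, by rintro _ ⟨n, rfl⟩; exact (hit n hb).1⟩
  have hlim := tendsto_atTop_ciInf hanti hbdd
  set u := ⨅ n, φ^[n] b with hu
  have hle : ∀ n, u ≤ φ^[n] b := fun n => ciInf_le hbdd n
  -- The gap comes from `u ≤ φ (φ b) < φ b ≤ ψ y`. Convergence is uniform because `φ^[n] (ψ y)` lies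
  -- between `φ^[n + 1] b` and `φ^[n] b`.
  refine ⟨u, ?_, ⟨φ b - φ (φ b), ?_, ?_⟩, ?_⟩
  · have h1 := (hH.tendsto u).comp ((tendsto_add_atTop_iff_nat 1).2 hlim)
    refine tendsto_nhds_unique (h1.congr fun n => ?_) hlim
    show H (φ^[n + 1] b) = _
    rw [iterate_succ_apply', hφH _ (hit n hb)]
  · exact sub_pos.2 (hmono (hφ hb) hb hφb)
  · intro y hy
    have h1 := hsep b hb y hy
    have h2 : u ≤ φ (φ b) := hle 2
    exact le_trans (by linarith) (le_abs_self _)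
  · intro ε hε
    obtain ⟨n₀, hn₀⟩ := (Metric.tendsto_atTop.1 hlim) ε hε
    refine ⟨n₀, fun n hn y hy => ?_⟩
    have h1 : φ^[n] (ψ y) ≤ φ^[n] b := hmon n (hψ hy) hb (hψ hy).2
    have h2 : φ^[n + 1] b ≤ φ^[n] (ψ y) := by
      rw [iterate_succ_apply]
      exact hmon n (hφ hb) (hψ hy) (hsep b hb y hy)
    have h3 := hn₀ n hn
    rw [Real.dist_eq, abs_lt] at h3
    rw [abs_le]
    constructor <;> linarith [hle (n + 1)]

theorem exists_limit_of_branches {H φ ψ : ℝ → ℝ} {a b : ℝ} (hH : Continuous H) (hab : a < b)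
    (hφ : MapsTo φ (Icc a b) (Icc a b)) (hφH : ∀ y ∈ Icc a b, H (φ y) = y)
    (hmono : StrictMonoOn φ (Icc a b)) (hψ : MapsTo ψ (Icc a b) (Icc a b))
    (hinj : InjOn ψ (Icc a b))
    (hsep : (∀ x ∈ Icc a b, ∀ y ∈ Icc a b, φ x ≤ ψ y) ∨
      (∀ x ∈ Icc a b, ∀ y ∈ Icc a b, ψ y ≤ φ x)) :
    ∃ u, H u = u ∧ (∃ δ > 0, ∀ y ∈ Icc a b, δ ≤ |ψ y - u|) ∧
      ∀ ε > 0, ∃ n₀, ∀ n ≥ n₀, ∀ y ∈ Icc a b, |φ^[n] (ψ y) - u| ≤ ε := by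
  rcases hsep with hsep | hsep
  · exact exists_limit_of_branches_right hH hab hφ hφH hmono hψ hinj hsep
  · have hm : ∀ w, w ∈ Icc (-b) (-a) → -w ∈ Icc a b := fun w hw =>
      ⟨by linarith [hw.2], by linarith [hw.1]⟩
    have hm' : ∀ w, w ∈ Icc a b → -w ∈ Icc (-b) (-a) := fun w hw =>
      ⟨neg_le_neg hw.2, neg_le_neg hw.1⟩
    obtain ⟨u, h1, ⟨δ, hδ, h2⟩, h3⟩ := exists_limit_of_branches_right (H := fun x => -H (-x))
      (φ := fun x => -φ (-x)) (ψ := fun x => -ψ (-x)) (a := -b) (b := -a) (by fun_prop)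
      (by linarith) (fun w hw => hm' _ (hφ (hm w hw)))
      (fun w hw => by simp [hφH _ (hm w hw)])
      (fun w hw w' hw' hlt => neg_lt_neg (hmono (hm w' hw') (hm w hw) (neg_lt_neg hlt)))
      (fun w hw => hm' _ (hψ (hm w hw)))
      (fun w hw w' hw' he => neg_injective (hinj (hm w hw) (hm w' hw') (neg_injective he)))
      (fun w hw w' hw' => neg_le_neg (hsep _ (hm w hw) _ (hm w' hw')))
    have hconj : ∀ n x, (fun x => -φ (-x))^[n] x = -φ^[n] (-x) := by
      intro n
      induction n with
      | zero => intro x; simp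
      | succ n ih => intro x; rw [iterate_succ_apply, ih, iterate_succ_apply, neg_neg]
    refine ⟨-u, by linarith, ⟨δ, hδ, fun y hy => ?_⟩, fun ε hε => ?_⟩
    · have e : ψ y - -u = -(-ψ (- -y) - u) := by rw [neg_neg]; ring
      rw [e, abs_neg]
      exact h2 _ (hm' y hy)
    · obtain ⟨n₀, hn₀⟩ := h3 ε hε
      refine ⟨n₀, fun n hn y hy => ?_⟩
      have := hn₀ n hn _ (hm' y hy)
      rw [hconj, neg_neg, neg_neg] at this
      have e : φ^[n] (ψ y) - -u = -(-φ^[n] (ψ y) - u) := by ring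
      rw [e, abs_neg]
      exact this

/-! ### Cylinders and itineraries -/

/-- The inverse branch of `h^[w.length]` indexed by the word `w`. -/
def branch (φ : Bool → ℝ → ℝ) : List Bool → ℝ → ℝ
  | [] => id
  | c :: w => φ c ∘ branch φ w

/-- The cylinder of the word `w`: the closure of the range of the branch of `w`. -/
def cylinder (φ : Bool → ℝ → ℝ) (a b : ℝ) (w : List Bool) : Set ℝ :=
  closure (branch φ w '' Icc a b)

theorem branch_append (φ : Bool → ℝ → ℝ) (v w : List Bool) :
    branch φ (v ++ w) = branch φ v ∘ branch φ w := by
  induction v with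
  | nil => rfl
  | cons c v ih => rw [List.cons_append, branch, ih, branch, comp_assoc]

theorem branch_flatten_replicate (φ : Bool → ℝ → ℝ) (v : List Bool) (n : ℕ) :
    branch φ (List.replicate n v).flatten = (branch φ v)^[n] := by
  induction n with
  | zero => rfl
  | succ n ih => rw [List.replicate_succ, List.flatten_cons, branch_append, ih, iterate_succ']

namespace IsBranchPair

variable {h : ℝ → ℝ} {a b : ℝ} {φ : Bool → ℝ → ℝ}

theorem mapsTo_branch (H : IsBranchPair h a b φ) (w : List Bool) :
    MapsTo (branch φ w) (Icc a b) (Icc a b) := by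
  induction w with
  | nil => exact mapsTo_id _
  | cons c w ih => exact (H.mapsTo c).comp ih

theorem iterate_branch (H : IsBranchPair h a b φ) (w : List Bool) :
    ∀ y ∈ Icc a b, h^[w.length] (branch φ w y) = y := by
  induction w with
  | nil => intro y _; rfl
  | cons c w ih =>
    intro y hy
    rw [List.length_cons, iterate_succ_apply, branch, comp_apply,
      H.rightInv c _ (H.mapsTo_branch w hy), ih y hy]

theorem branch_mono_or_anti (H : IsBranchPair h a b φ) (w : List Bool) :
    StrictMonoOn (branch φ w) (Icc a b) ∨ StrictAntiOn (branch φ w) (Icc a b) := by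
  induction w with
  | nil => exact Or.inl strictMonoOn_id
  | cons c w ih =>
    have hm := H.mapsTo_branch w
    cases c <;> rcases ih with ih | ih
    · exact Or.inl (H.strictMonoOn.comp ih hm)
    · exact Or.inr (H.strictMonoOn.comp_strictAntiOn ih hm)
    · exact Or.inr (H.strictAntiOn.comp_strictMonoOn ih hm)
    · exact Or.inl (H.strictAntiOn.comp ih hm)

theorem cylinder_append_subset (H : IsBranchPair h a b φ) (v w : List Bool) :
    cylinder φ a b (v ++ w) ⊆ cylinder φ a b v := by
  rw [cylinder, cylinder, branch_append, image_comp]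
  exact closure_mono (image_mono (H.mapsTo_branch w).image_subset)

theorem cylinder_subset_Icc (H : IsBranchPair h a b φ) (w : List Bool) :
    cylinder φ a b w ⊆ Icc a b :=
  closure_minimal (H.mapsTo_branch w).image_subset isClosed_Icc

theorem cylinder_nonempty (H : IsBranchPair h a b φ) (w : List Bool) :
    (cylinder φ a b w).Nonempty :=
  ((nonempty_Icc.2 H.lt.le).image _).closure

theorem isCompact_cylinder (H : IsBranchPair h a b φ) (w : List Bool) :
    IsCompact (cylinder φ a b w) :=
  isCompact_Icc.of_isClosed_subset isClosed_closure (H.cylinder_subset_Icc w)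

/-- On the range of the branch this is the inverse relation; continuity of `h` carries it to the
closure. Taking closures supplies the compactness that discontinuous branches lack. -/
theorem iterate_mem_cylinder (H : IsBranchPair h a b φ) (v w : List Bool) {x : ℝ}
    (hx : x ∈ cylinder φ a b (v ++ w)) : h^[v.length] x ∈ cylinder φ a b w := by
  have h1 := image_closure_subset_closure_image (H.continuous.iterate v.length)
    (mem_image_of_mem _ hx)
  refine closure_mono ?_ h1
  rintro _ ⟨_, ⟨y, hy, rfl⟩, rfl⟩
  rw [branch_append, comp_apply, H.iterate_branch v _ (H.mapsTo_branch w hy)]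
  exact mem_image_of_mem _ hy

/-- The cylinder of `w` lies between the images of the endpoints. -/
theorem cylinder_subset_uIcc (H : IsBranchPair h a b φ) (w : List Bool) :
    cylinder φ a b w ⊆ uIcc (branch φ w a) (branch φ w b) := by
  refine closure_minimal ?_ isClosed_Icc
  rintro _ ⟨y, hy, rfl⟩
  have ha : a ∈ Icc a b := left_mem_Icc.2 H.lt.le
  have hb : b ∈ Icc a b := right_mem_Icc.2 H.lt.le
  rcases H.branch_mono_or_anti w with hw | hw
  · exact mem_uIcc.2 (Or.inl ⟨hw.monotoneOn ha hy hy.1, hw.monotoneOn hy hb hy.2⟩)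
  · exact mem_uIcc.2 (Or.inr ⟨hw.antitoneOn hy hb hy.2, hw.antitoneOn ha hy hy.1⟩)

theorem branch_mem_uIcc (H : IsBranchPair h a b φ) (w : List Bool) {y : ℝ} (hy : y ∈ Icc a b) :
    branch φ w y ∈ uIcc (branch φ w a) (branch φ w b) :=
  H.cylinder_subset_uIcc w (subset_closure (mem_image_of_mem _ hy))

theorem uIcc_append_subset (H : IsBranchPair h a b φ) (v w : List Bool) :
    uIcc (branch φ (v ++ w) a) (branch φ (v ++ w) b) ⊆ uIcc (branch φ v a) (branch φ v b) := by
  rw [branch_append]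
  exact uIcc_subset_uIcc
    (H.branch_mem_uIcc v (H.mapsTo_branch w (left_mem_Icc.2 H.lt.le)))
    (H.branch_mem_uIcc v (H.mapsTo_branch w (right_mem_Icc.2 H.lt.le)))

/-- The intervals spanned by two cylinders whose words first differ in the last letter do not
overlap. -/
theorem subsingleton_uIcc_inter (H : IsBranchPair h a b φ) (v : List Bool) :
    (uIcc (branch φ (v ++ [false]) a) (branch φ (v ++ [false]) b) ∩
      uIcc (branch φ (v ++ [true]) a) (branch φ (v ++ [true]) b)).Subsingleton := by
  have ha : a ∈ Icc a b := left_mem_Icc.2 H.lt.le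
  have hb : b ∈ Icc a b := right_mem_Icc.2 H.lt.le
  have hle : ∀ {p q r s : ℝ}, p ≤ r → p ≤ s → q ≤ r → q ≤ s →
      (uIcc p q ∩ uIcc r s).Subsingleton := by
    intro p q r s h1 h2 h3 h4 x hx y hy
    have e1 : max p q ≤ min r s := max_le (le_min h1 h2) (le_min h3 h4)
    have := hx.1.2; have := hx.2.1; have := hy.1.2; have := hy.2.1
    apply le_antisymm <;> linarith
  have hs : (∀ x ∈ Icc a b, ∀ y ∈ Icc a b, branch φ (v ++ [false]) x ≤ branch φ (v ++ [true]) y) ∨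
      (∀ x ∈ Icc a b, ∀ y ∈ Icc a b, branch φ (v ++ [true]) y ≤ branch φ (v ++ [false]) x) := by
    simp only [branch_append, comp_apply, branch, id]
    rcases H.branch_mono_or_anti v with hv | hv <;> rcases H.separated with hs | hs
    · exact Or.inl fun x hx y hy => hv.monotoneOn (H.mapsTo _ hx) (H.mapsTo _ hy) (hs x hx y hy)
    · exact Or.inr fun x hx y hy => hv.monotoneOn (H.mapsTo _ hy) (H.mapsTo _ hx) (hs x hx y hy)
    · exact Or.inr fun x hx y hy => hv.antitoneOn (H.mapsTo _ hx) (H.mapsTo _ hy) (hs x hx y hy)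
    · exact Or.inl fun x hx y hy => hv.antitoneOn (H.mapsTo _ hy) (H.mapsTo _ hx) (hs x hx y hy)
  rcases hs with hs | hs
  · exact hle (hs _ ha _ ha) (hs _ ha _ hb) (hs _ hb _ ha) (hs _ hb _ hb)
  · rw [inter_comm]
    exact hle (hs _ ha _ ha) (hs _ hb _ ha) (hs _ ha _ hb) (hs _ hb _ hb)

/-- The diameter of the cylinder of `w` is at most the distance of the images of the endpoints. -/
theorem abs_sub_le_of_mem_cylinder (H : IsBranchPair h a b φ) (w : List Bool) {x y : ℝ}
    (hx : x ∈ cylinder φ a b w) (hy : y ∈ cylinder φ a b w) :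
    |y - x| ≤ |branch φ w b - branch φ w a| :=
  abs_sub_le_of_uIcc_subset_uIcc
    (uIcc_subset_uIcc (H.cylinder_subset_uIcc w hx) (H.cylinder_subset_uIcc w hy))

/-- The cylinders along `α` shrink to a point. -/
def Shrinks (φ : Bool → ℝ → ℝ) (a b : ℝ) (α : ℕ → Bool) : Prop :=
  ∀ ε > 0, ∃ n, |branch φ (segment α 0 n) b - branch φ (segment α 0 n) a| < ε

/-- Nested intervals of length at least `ε` all contain `(L, L + ε)`, where `L` is the supremum of
their left ends. -/
theorem nonempty_interior_of_not_shrinks (H : IsBranchPair h a b φ) {α : ℕ → Bool}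
    (hα : ¬ Shrinks φ a b α) :
    (interior (⋂ n, uIcc (branch φ (segment α 0 n) a) (branch φ (segment α 0 n) b))).Nonempty := by
  simp only [Shrinks, not_forall, not_exists, not_lt] at hα
  obtain ⟨ε, hε, hw⟩ := hα
  set p : ℕ → ℝ := fun n => branch φ (segment α 0 n) a
  set q : ℕ → ℝ := fun n => branch φ (segment α 0 n) b
  have hnest : ∀ n k, n ≤ k → uIcc (p k) (q k) ⊆ uIcc (p n) (q n) := by
    intro n k hnk
    obtain ⟨j, rfl⟩ := Nat.exists_eq_add_of_le hnk
    have := H.uIcc_append_subset (segment α 0 n) (segment α (0 + n) j)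
    rwa [← segment_add] at this
  have hmin : ∀ n k, n ≤ k → min (p n) (q n) ≤ min (p k) (q k) := fun n k hnk =>
    (uIcc_subset_uIcc_iff_le.1 (hnest n k hnk)).1
  have hmax : ∀ n k, n ≤ k → max (p k) (q k) ≤ max (p n) (q n) := fun n k hnk =>
    (uIcc_subset_uIcc_iff_le.1 (hnest n k hnk)).2
  have hgap : ∀ n, min (p n) (q n) + ε ≤ max (p n) (q n) := by
    intro n
    have h1 : max (p n) (q n) - min (p n) (q n) = |q n - p n| := max_sub_min_eq_abs _ _
    have h2 : ε ≤ |q n - p n| := hw n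
    linarith
  have hcross : ∀ n k, min (p n) (q n) + ε ≤ max (p k) (q k) := by
    intro n k
    have h1 := hmin n _ (le_max_left n k)
    have h2 := hmax k _ (le_max_right n k)
    have h3 := hgap (max n k)
    linarith
  set L := ⨆ n, min (p n) (q n)
  have hbdd : BddAbove (range fun n => min (p n) (q n)) := by
    refine ⟨max (p 0) (q 0), ?_⟩
    rintro _ ⟨n, rfl⟩
    have := hcross n 0
    show min (p n) (q n) ≤ _
    linarith
  have hL1 : ∀ n, min (p n) (q n) ≤ L := fun n => le_ciSup hbdd n
  have hL2 : ∀ k, L ≤ max (p k) (q k) - ε := fun k => ciSup_le fun n => by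
    have := hcross n k
    linarith
  refine ⟨L + ε / 2, mem_interior.2 ⟨Ioo L (L + ε), ?_, isOpen_Ioo, by constructor <;> linarith⟩⟩
  intro x hx
  refine mem_iInter.2 fun n => ⟨(hL1 n).trans hx.1.le, ?_⟩
  have := hL2 n
  exact le_trans hx.2.le (by linarith)

/-- Two sequences part at their first difference into intervals meeting in at most one point, so the
open sets attached to non-shrinking sequences are disjoint and nonempty; the line admits only
countably many. -/
theorem countable_not_shrinks (H : IsBranchPair h a b φ) :
    {α : ℕ → Bool | ¬ Shrinks φ a b α}.Countable := by
  classical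
  refine PairwiseDisjoint.countable_of_isOpen
    (s := fun α : ℕ → Bool =>
      interior (⋂ n, uIcc (branch φ (segment α 0 n) a) (branch φ (segment α 0 n) b)))
    ?_ (fun α _ => isOpen_interior) (fun α hα => H.nonempty_interior_of_not_shrinks hα)
  have main : ∀ (α β : ℕ → Bool) (n : ℕ), segment α 0 n = segment β 0 n → α n = false →
      β n = true →
      interior (⋂ n, uIcc (branch φ (segment α 0 n) a) (branch φ (segment α 0 n) b)) ∩
        interior (⋂ n, uIcc (branch φ (segment β 0 n) a) (branch φ (segment β 0 n) b)) = ∅ := by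
    intro α β n he h0 h1
    rw [← interior_inter]
    have hs := H.subsingleton_uIcc_inter (segment α 0 n)
    have e0 : segment α 0 (n + 1) = segment α 0 n ++ [false] := by
      rw [segment_add, Nat.zero_add, segment, segment, h0]
    have e1 : segment β 0 (n + 1) = segment α 0 n ++ [true] := by
      rw [segment_add, Nat.zero_add, segment, segment, h1, he]
    rw [← e0, ← e1] at hs
    refine subset_empty_iff.1 (subset_trans (interior_mono
      (inter_subset_inter (iInter_subset _ (n + 1)) (iInter_subset _ (n + 1)))) ?_)
    rw [interior_eq_empty_iff_dense_compl.2 (hs.finite.countable.dense_compl ℝ)]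
  intro α _ β _ hne
  have hex : ∃ n, α n ≠ β n := Function.ne_iff.1 hne
  have hn := Nat.find_spec hex
  have he : segment α 0 (Nat.find hex) = segment β 0 (Nat.find hex) :=
    segment_congr fun i hi => by
      rw [Nat.zero_add]
      exact not_not.1 (Nat.find_min hex hi)
  rw [Function.onFun, disjoint_iff_inter_eq_empty]
  cases h0 : α (Nat.find hex) <;> cases h1 : β (Nat.find hex)
  · exact absurd (h0.trans h1.symm) hn
  · exact main α β _ he h0 h1
  · rw [inter_comm]; exact main β α _ he.symm h1 h0
  · exact absurd (h0.trans h1.symm) hn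

/-- The point `x` has the itinerary `α`. -/
def HasCode (φ : Bool → ℝ → ℝ) (a b : ℝ) (x : ℝ) (α : ℕ → Bool) : Prop :=
  ∀ n, x ∈ cylinder φ a b (segment α 0 n)

theorem exists_hasCode (H : IsBranchPair h a b φ) (α : ℕ → Bool) :
    ∃ x, HasCode φ a b x α := by
  have := IsCompact.nonempty_iInter_of_sequence_nonempty_isCompact_isClosed
    (fun n => cylinder φ a b (segment α 0 n))
    (fun n => by rw [segment_add]; exact H.cylinder_append_subset _ _)
    (fun n => H.cylinder_nonempty _) (H.isCompact_cylinder _) (fun n => isClosed_closure)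
  obtain ⟨x, hx⟩ := this
  exact ⟨x, mem_iInter.1 hx⟩

theorem iterate_mem_of_hasCode (H : IsBranchPair h a b φ) {α : ℕ → Bool} {x : ℝ}
    (hx : HasCode φ a b x α) (t n : ℕ) : h^[t] x ∈ cylinder φ a b (segment α t n) := by
  have h1 := hx (t + n)
  rw [segment_add, Nat.zero_add] at h1
  have := H.iterate_mem_cylinder _ _ h1
  rwa [length_segment] at this

/-- If the itinerary of `x` reads `v ++ w` at `t`, then `x` is in the cylinder of `w` at
`t + v.length`. -/
theorem iterate_mem_of_segment (H : IsBranchPair h a b φ) {α : ℕ → Bool} {x : ℝ}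
    (hx : HasCode φ a b x α) {t : ℕ} {w : List Bool} (hw : segment α t w.length = w) :
    h^[t] x ∈ cylinder φ a b w := by
  have := H.iterate_mem_of_hasCode hx t w.length
  rwa [hw] at this

/-- The limit fixed point belonging to an increasing branch of a word `v` that begins with
`false`. -/
theorem exists_fixed_limit (H : IsBranchPair h a b φ) {v : List Bool}
    (hv : StrictMonoOn (branch φ (false :: v)) (Icc a b)) :
    ∃ u, h^[v.length + 1] u = u ∧ (∃ δ > 0, ∀ y ∈ cylinder φ a b [true], δ ≤ |y - u|) ∧
      ∀ ε > 0, ∃ n₀, ∀ n ≥ n₀,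
        ∀ y ∈ cylinder φ a b ((List.replicate n (false :: v)).flatten ++ [true]), |y - u| ≤ ε := by
  obtain ⟨u, h1, ⟨δ, hδ, h2⟩, h3⟩ := exists_limit_of_branches (H := h^[v.length + 1])
    (φ := branch φ (false :: v)) (ψ := φ true)
    (H.continuous.iterate _) H.lt (H.mapsTo_branch _) (H.iterate_branch (false :: v))
    hv (H.mapsTo true)
    H.strictAntiOn.injOn
    (H.separated.imp (fun hs x hx y hy => hs _ (H.mapsTo_branch v hx) y hy)
      (fun hs x hx y hy => hs _ (H.mapsTo_branch v hx) y hy))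
  refine ⟨u, h1, ⟨δ, hδ, fun y hy => ?_⟩, fun ε hε => ?_⟩
  · have hcl : IsClosed {y : ℝ | δ ≤ |y - u|} := isClosed_le (by fun_prop) (by fun_prop)
    refine closure_minimal ?_ hcl hy
    rintro _ ⟨y, hy, rfl⟩
    exact h2 y hy
  · obtain ⟨n₀, hn₀⟩ := h3 ε hε
    refine ⟨n₀, fun n hn y hy => ?_⟩
    have hcl : IsClosed {y : ℝ | |y - u| ≤ ε} := isClosed_le (by fun_prop) (by fun_prop)
    refine closure_minimal ?_ hcl hy
    rintro _ ⟨y, hy, rfl⟩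
    rw [branch_append, branch_flatten_replicate]
    exact hn₀ n hn y hy

end IsBranchPair

/-! ### Chaotic families for a map with two branches -/

/-- A family of points of the real line that is scrambled for `h` and whose orbits accumulate at
the whole family and at cycles of arbitrarily large period. -/
structure IsChaoticFamily (h : ℝ → ℝ) (δ : ℝ) (S : Set ℝ) : Prop where
  not_countable : ¬ S.Countable
  mapsTo : MapsTo h S S
  separated : ∀ x ∈ S, ∀ y ∈ S, x ≠ y → ∀ M, ∃ t ≥ M, δ ≤ |h^[t] x - h^[t] y|
  proximal : ∀ x ∈ S, ∀ y ∈ S, ∀ ε > 0, ∀ M, ∃ t ≥ M, |h^[t] x - h^[t] y| ≤ ε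
  separated_periodic : ∀ x ∈ S, ∀ L > 0, ∀ p, h^[L] p = p →
    ∀ M, ∃ t ≥ M, δ / 2 ≤ |h^[t] x - h^[t] p|
  accumulates : ∀ x ∈ S, ∀ y ∈ S, ∀ ε > 0, ∀ M, ∃ t ≥ M, |h^[t] x - y| ≤ ε
  accumulates_periodic : ∀ N, ∃ p, (∃ L > 0, h^[L] p = p) ∧ (∀ j, 0 < j → j < N → h^[j] p ≠ p) ∧
    ∀ x ∈ S, ∀ ε > 0, ∀ M, ∃ t ≥ M, |h^[t] x - p| ≤ ε

namespace IsBranchPair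

variable {h : ℝ → ℝ} {a b : ℝ} {φ : Bool → ℝ → ℝ}

/-- If all words occur in `α`, then the orbit of a point with itinerary `α` visits each cylinder
at arbitrarily late times, also when it is shifted. -/
theorem exists_iterate_mem (H : IsBranchPair h a b φ) {α : ℕ → Bool} {x : ℝ}
    (hx : HasCode φ a b x α) (hα : ∀ w M, ∃ t, M ≤ t ∧ segment α t w.length = w)
    (w : List Bool) (i M : ℕ) : ∃ t ≥ M, h^[t + i] x ∈ cylinder φ a b w := by
  obtain ⟨t, ht, hw⟩ := hα w (M + i)
  refine ⟨t - i, by omega, ?_⟩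
  rw [Nat.sub_add_cancel (by omega)]
  exact H.iterate_mem_of_segment hx hw

/-- Cycles near which all cylinders `v ^ n 1` accumulate, of arbitrarily large period. -/
theorem exists_periodic_limit (H : IsBranchPair h a b φ) (N : ℕ) :
    ∃ p, (∃ L > 0, h^[L] p = p) ∧ (∀ j, 0 < j → j < N → h^[j] p ≠ p) ∧
      ∀ ε > 0, ∃ w, ∀ y ∈ cylinder φ a b w, |y - p| ≤ ε := by
  obtain ⟨u, -, ⟨δ, hδ, hsep⟩, hlim⟩ := H.exists_fixed_limit (v := []) H.strictMonoOn
  obtain ⟨n₀, hn₀⟩ := hlim (δ / 2) (by linarith)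
  have hrep : ∀ n, (List.replicate n [false]).flatten = List.replicate n false := by simp
  -- With this `q` the orbit of `p` stays within `δ / 2` of `u` up to time `N` and is `δ` away at
  -- time `q + 1`, which excludes periods below `N`.
  set q := N + n₀ with hq
  set r : List Bool := List.replicate q false ++ [true] with hr
  -- The word `0^(q+1) 1` has a decreasing branch; doubling the word makes the branch increasing, as
  -- the limit lemma requires.
  have hrr : StrictMonoOn (branch φ (false :: (r ++ (false :: r)))) (Icc a b) := by
    have e : false :: (r ++ (false :: r)) = (false :: r) ++ (false :: r) := rfl
    rw [e, branch_append]
    have hm := H.mapsTo_branch (false :: r)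
    rcases H.branch_mono_or_anti (false :: r) with hv | hv
    · exact hv.comp hv hm
    · exact hv.comp hv hm
  obtain ⟨p, hp, -, hplim⟩ := H.exists_fixed_limit hrr
  set V := r ++ (false :: r) with hV
  have hpmem : p ∈ cylinder φ a b (false :: V) := by
    have hcl : IsClosed (cylinder φ a b (false :: V)) := isClosed_closure
    refine hcl.closure_subset (Metric.mem_closure_iff.2 fun ε hε => ?_)
    obtain ⟨n₁, hn₁⟩ := hplim (ε / 2) (by linarith)
    obtain ⟨y, hy⟩ := H.cylinder_nonempty ((List.replicate (n₁ + 1) (false :: V)).flatten ++ [true])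
    have h1 := hn₁ (n₁ + 1) (by omega) y hy
    refine ⟨y, ?_, ?_⟩
    · rw [List.replicate_succ, List.flatten_cons, List.append_assoc] at hy
      exact H.cylinder_append_subset _ _ hy
    · rw [dist_comm, Real.dist_eq]; linarith
  have hword : false :: V = List.replicate (q + 1) false ++ ([true] ++ (false :: r)) := by
    rw [hV, hr, List.replicate_succ]; simp
  -- the orbit of `p` is close to `u` for a long time and then visits the cylinder of `true`
  have hnear : ∀ i ≤ N, |h^[i] p - u| ≤ δ / 2 := by
    intro i hi
    have e : false :: V = List.replicate i false ++
        ((List.replicate (q + 1 - i) false ++ [true]) ++ (false :: r)) := by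
      rw [hword, ← List.append_assoc, ← List.append_assoc, ← List.append_assoc,
        ← List.replicate_add,
        Nat.add_sub_cancel' (by omega : i ≤ q + 1)]
    rw [e] at hpmem
    have h1 := H.cylinder_append_subset _ _ (H.iterate_mem_cylinder _ _ hpmem)
    rw [List.length_replicate, ← hrep] at h1
    exact hn₀ _ (by omega) _ h1
  have hfar : δ ≤ |h^[q + 1] p - u| := by
    rw [hword] at hpmem
    have h1 := H.cylinder_append_subset _ _ (H.iterate_mem_cylinder _ _ hpmem)
    rw [List.length_replicate] at h1
    exact hsep _ h1
  refine ⟨p, ⟨_, Nat.succ_pos _, hp⟩, fun j hj hjN hper => ?_, fun ε hε => ?_⟩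
  · have h1 : IsPeriodicPt h j p := hper
    rw [← h1.iterate_mod_apply (q + 1)] at hfar
    have h2 := Nat.mod_lt (q + 1) hj
    linarith [hnear _ (by omega : (q + 1) % j ≤ N)]
  · obtain ⟨n₁, hn₁⟩ := hplim ε hε
    exact ⟨_, hn₁ n₁ le_rfl⟩

/-- Orbits separate by `δ / 2` when one visits the cylinder of `1` and the other is inside a long
run of 0. An orbit is separated likewise from its own shifts, which handles points of one orbit and
periodic points. -/
theorem exists_isChaoticFamily (H : IsBranchPair h a b φ) :
    ∃ δ > 0, ∃ S, IsChaoticFamily h δ S := by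
  obtain ⟨A, hA⟩ := exists_isScrambledFamily
  have hocc := hA.occurs
  have hsync := hA.synchronised
  have hdiff := hA.separated
  obtain ⟨u, -, ⟨δ, hδ, hsep⟩, hlim⟩ := H.exists_fixed_limit (v := []) H.strictMonoOn
  have hrep : ∀ n, (List.replicate n [false]).flatten = List.replicate n false := by simp
  simp only [hrep] at hlim
  obtain ⟨n₀, hn₀⟩ := hlim (δ / 2) (by linarith)
  choose X hX using fun η => H.exists_hasCode (A η)
  set G : Set (ℕ → Bool) := {η | Shrinks φ a b (A η)} with hG
  have hunc : ¬ Countable (ℕ → Bool) := by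
    rw [← Cardinal.mk_le_aleph0_iff, not_le]
    simp [Cardinal.aleph0_lt_continuum]
  have hGc : ¬ G.Countable := by
    intro hc
    have h1 : (Gᶜ).Countable := H.countable_not_shrinks.preimage hA.injective
    have h2 := hc.union h1
    rw [union_compl_self] at h2
    exact hunc (countable_univ_iff.1 h2)
  have hvisit : ∀ η w i M, ∃ t ≥ M, h^[t + i] (X η) ∈ cylinder φ a b w := fun η w i M =>
    H.exists_iterate_mem (hX η) (hocc η) w i M
  -- two points of one orbit are far apart again and again
  have hself : ∀ η d, 0 < d → ∀ i M, ∃ t ≥ M,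
      δ / 2 ≤ |h^[t + i] (X η) - h^[t + i + d] (X η)| := by
    intro η d hd i M
    obtain ⟨t, ht, hmem⟩ := hvisit η ([true] ++ (List.replicate (d - 1) false ++
      (List.replicate n₀ false ++ [true]))) i M
    refine ⟨t, ht, ?_⟩
    have h1 := hsep _ (H.cylinder_append_subset _ _ hmem)
    have h2 := H.iterate_mem_cylinder _ _ (H.iterate_mem_cylinder _ _ hmem)
    rw [← iterate_add_apply, ← iterate_add_apply] at h2
    simp only [List.length_replicate, List.length_singleton] at h2
    rw [show d - 1 + 1 + (t + i) = t + i + d by omega] at h2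
    have h3 := hn₀ n₀ le_rfl _ h2
    have h4 := abs_sub_le (h^[t + i] (X η)) (h^[t + i + d] (X η)) u
    linarith
  have hother : ∀ η η', η ≠ η' → ∀ i j M, ∃ t ≥ M,
      δ / 2 ≤ |h^[t + i] (X η) - h^[t + j] (X η')| := by
    intro η η' hne
    obtain ⟨ζ, ζ', hζ, hd⟩ := hdiff η η' hne
    have main : ∀ i j M, ∃ t ≥ M, δ / 2 ≤ |h^[t + i] (X ζ) - h^[t + j] (X ζ')| := by
      intro i j M
      -- The 1 stands opposite the middle of a run longer than all lags, so at least `n₀` zeros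
      -- remain after shifting by `i` and `j`.
      obtain ⟨k, t, hk, ht, e1, e2⟩ := hd (M + i + j + n₀)
      refine ⟨t + k - i, by omega, ?_⟩
      rw [Nat.sub_add_cancel (by omega)]
      have h1 := hsep _ (H.iterate_mem_of_segment (hX ζ) (w := [true]) e1)
      have e3 : segment (A ζ') t (List.replicate (2 * k + 1) false ++ [true]).length =
          List.replicate (2 * k + 1) false ++ [true] := by simpa using e2
      rw [show 2 * k + 1 = (k - i + j) + (k + 1 + i - j) by omega, List.replicate_add,
        List.append_assoc] at e3
      have h2 := H.iterate_mem_of_segment (hX ζ') (segment_append_right e3)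
      rw [List.length_replicate, show t + (k - i + j) = t + k - i + j by omega] at h2
      have h3 := hn₀ _ (by omega) _ h2
      have h4 := abs_sub_le (h^[t + k] (X ζ)) (h^[t + k - i + j] (X ζ')) u
      linarith
    intro i j M
    rcases hζ with ⟨rfl, rfl⟩ | ⟨rfl, rfl⟩
    · exact main i j M
    · obtain ⟨t, ht, h1⟩ := main j i M
      exact ⟨t, ht, by rwa [abs_sub_comm]⟩
  set S : Set ℝ := {x | ∃ η ∈ G, ∃ i, x = h^[i] (X η)} with hS
  have hacc : ∀ x ∈ S, ∀ w M, ∃ t ≥ M, h^[t] x ∈ cylinder φ a b w := by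
    rintro _ ⟨η, -, i, rfl⟩ w M
    obtain ⟨t, ht, h1⟩ := hvisit η w i M
    exact ⟨t, ht, by rwa [← iterate_add_apply]⟩
  refine ⟨δ / 2, by linarith, S, ?_, ?_, ?_, ?_, ?_, ?_, ?_⟩
  · intro hc
    refine hGc (MapsTo.countable_of_injOn (f := X) (t := S) (fun η hη => ⟨η, hη, 0, rfl⟩) ?_ hc)
    intro η _ η' _ he
    by_contra hne
    obtain ⟨t, -, h1⟩ := hother η η' hne 0 0 0
    rw [he, sub_self, abs_zero] at h1
    linarith
  · rintro _ ⟨η, hη, i, rfl⟩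
    exact ⟨η, hη, i + 1, (iterate_succ_apply' h i _).symm⟩
  · rintro _ ⟨η, -, i, rfl⟩ _ ⟨η', -, j, rfl⟩ hne M
    simp only [← iterate_add_apply]
    by_cases hηη : η = η'
    · subst hηη
      rcases lt_trichotomy i j with hij | hij | hij
      · obtain ⟨t, ht, h1⟩ := hself η (j - i) (by omega) i M
        rw [show t + i + (j - i) = t + j by omega] at h1
        exact ⟨t, ht, h1⟩
      · exact absurd (by rw [hij]) hne
      · obtain ⟨t, ht, h1⟩ := hself η (i - j) (by omega) j M
        rw [show t + j + (i - j) = t + i by omega, abs_sub_comm] at h1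
        exact ⟨t, ht, h1⟩
    · exact hother η η' hηη i j M
  · rintro _ ⟨η, -, i, rfl⟩ _ ⟨η', -, j, rfl⟩ ε hε M
    simp only [← iterate_add_apply]
    obtain ⟨n₁, hn₁⟩ := hlim (ε / 2) (by linarith)
    obtain ⟨k, t, hk, ht, hw⟩ := hsync η η' (M + i + j + n₁)
    have hclose : ∀ ζ ∈ ({η, η'} : Set (ℕ → Bool)), ∀ l ≤ i + j, |h^[t + l] (X ζ) - u| ≤ ε / 2 := by
      intro ζ hζ l hl
      have e : segment (A ζ) t (List.replicate k false ++ [true]).length =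
          List.replicate k false ++ [true] := by simpa using hw ζ hζ
      rw [show k = l + (k - l) by omega, List.replicate_add, List.append_assoc] at e
      have h1 := H.iterate_mem_of_segment (hX ζ) (segment_append_right e)
      rw [List.length_replicate] at h1
      exact hn₁ _ (by omega) _ h1
    refine ⟨t, by omega, ?_⟩
    have h1 := hclose η (by simp) i (by omega)
    have h2 := hclose η' (by simp) j (by omega)
    have h3 := abs_sub_le (h^[t + i] (X η)) u (h^[t + j] (X η'))
    rw [abs_sub_comm u] at h3
    linarith
  · rintro _ ⟨η, -, i, rfl⟩ L hL p hp M
    obtain ⟨t, ht, h1⟩ := hself η L hL i M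
    have h2 : h^[t + L] p = h^[t] p := by rw [iterate_add_apply, hp]
    have h3 := abs_sub_le (h^[t + i] (X η)) (h^[t] p) (h^[t + i + L] (X η))
    -- At times `t` and `t + L` the point `p` is in the same place while the orbit has moved by `δ /
    -- 2`, so one of the two distances is at least half of that.
    rcases le_or_gt (δ / 2 / 2) (|h^[t + i] (X η) - h^[t] p|) with h4 | h4
    · exact ⟨t, ht, by rwa [← iterate_add_apply]⟩
    · refine ⟨t + L, by omega, ?_⟩
      rw [← iterate_add_apply, h2, show t + L + i = t + i + L by omega, abs_sub_comm]
      linarith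
  · rintro x hx _ ⟨η', hη', j, rfl⟩ ε hε M
    -- Shrinking is known for the code of `X η'` only, so `X η'` is approximated first and `h^[j]`
    -- transports the approximation.
    obtain ⟨ρ, hρ, hcont⟩ := Metric.continuous_iff.1 (H.continuous.iterate j) (X η') ε hε
    obtain ⟨n, hn⟩ := hη' ρ hρ
    obtain ⟨t, ht, hmem⟩ := hacc x hx (segment (A η') 0 n) M
    refine ⟨j + t, by omega, ?_⟩
    rw [iterate_add_apply, ← Real.dist_eq]
    refine (hcont _ ?_).le
    rw [Real.dist_eq]
    exact (H.abs_sub_le_of_mem_cylinder _ (hX η' n) hmem).trans_lt hn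
  · intro N
    obtain ⟨p, h1, h2, h3⟩ := H.exists_periodic_limit N
    refine ⟨p, h1, h2, fun x hx ε hε M => ?_⟩
    obtain ⟨w, hw⟩ := h3 ε hε
    obtain ⟨t, ht, hmem⟩ := hacc x hx w M
    exact ⟨t, ht, hw _ hmem⟩

end IsBranchPair

/-- A power of an interval map with a point of odd period `m ≥ 3` admits a chaotic family. -/
theorem exists_isChaoticFamily_iterate {f : ℝ → ℝ} (hf : Continuous f) {m n : ℕ} (hm : 3 ≤ m)
    (hodd : Odd m) {c : ℝ} (hc : minimalPeriod f c = m) (hn : n = 2 ∨ m ≤ n) :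
    ∃ δ > 0, ∃ S, IsChaoticFamily f^[n] δ S := by
  have hfold : HasFold f^[n] := by
    rcases hn with rfl | hn
    · exact hasFold_iterate_two hf hm hodd hc
    · exact hasFold_iterate_of_le hf (by omega) hodd hc hn
  obtain ⟨a, b, φ, H⟩ := hfold.exists_isBranchPair (hf.iterate n)
  exact H.exists_isChaoticFamily

/-! ### Return from the line to the interval -/

theorem frequently_atTop_of_mul {N : ℕ} (hN : 0 < N) {P : ℕ → Prop}
    (h : ∀ M, ∃ t ≥ M, P (N * t)) : ∃ᶠ j in atTop, P j := by
  refine frequently_atTop.2 fun M => ?_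
  obtain ⟨t, ht, hP⟩ := h M
  exact ⟨N * t, le_trans ht (Nat.le_mul_of_pos_left t hN), hP⟩

theorem mem_omegaLimitPt_of_frequently {a b : ℝ} {f : Icc a b → Icc a b} {x y : Icc a b}
    (h : ∀ ε > 0, ∃ᶠ j in atTop, |(f^[j] x : ℝ) - y| ≤ ε) : y ∈ omegaLimitPt f x := by
  rw [omegaLimitPt, mem_omegaLimit_singleton_iff_mapClusterPt, mapClusterPt_iff_frequently]
  intro s hs
  obtain ⟨ε, hε, hs⟩ := Metric.mem_nhds_iff.1 hs
  refine (h (ε / 2) (by linarith)).mono fun j hj => hs ?_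
  rw [Metric.mem_ball, Subtype.dist_eq, Real.dist_eq]
  linarith

theorem isBoundedUnder_abs_sub {a b : ℝ} (u v : ℕ → Icc a b) :
    IsBoundedUnder (· ≤ ·) atTop (fun j => |(u j : ℝ) - v j|) :=
  isBoundedUnder_of ⟨b - a, fun j => abs_le.2
    ⟨by linarith [(u j).2.1, (v j).2.2], by linarith [(u j).2.2, (v j).2.1]⟩⟩

theorem le_limsup_abs_sub {a b δ : ℝ} {u v : ℕ → Icc a b}
    (h : ∃ᶠ j in atTop, δ ≤ |(u j : ℝ) - v j|) :
    δ ≤ limsup (fun j => |(u j : ℝ) - v j|) atTop :=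
  le_limsup_of_frequently_le h (isBoundedUnder_abs_sub u v)

theorem liminf_abs_sub_eq_zero {a b : ℝ} {u v : ℕ → Icc a b}
    (h : ∀ ε > 0, ∃ᶠ j in atTop, |(u j : ℝ) - v j| ≤ ε) :
    liminf (fun j => |(u j : ℝ) - v j|) atTop = 0 := by
  have hbdd : IsBoundedUnder (· ≥ ·) atTop (fun j => |(u j : ℝ) - v j|) :=
    isBoundedUnder_of ⟨0, fun j => abs_nonneg _⟩
  refine le_antisymm (le_of_forall_pos_le_add fun ε hε => ?_) ?_
  · rw [zero_add]
    exact liminf_le_of_frequently_le (h ε hε) hbdd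
  · exact le_liminf_of_le (isBoundedUnder_abs_sub u v).isCoboundedUnder_ge
      (Eventually.of_forall fun j => abs_nonneg _)

/-- The extension of a self-map of `[a, b]` to the line that is constant on both sides. -/
noncomputable def lineExtension {a b : ℝ} (hab : a ≤ b) (f : Icc a b → Icc a b) (x : ℝ) : ℝ :=
  f (projIcc a b hab x)

theorem continuous_lineExtension {a b : ℝ} (hab : a ≤ b) {f : Icc a b → Icc a b}
    (hf : Continuous f) : Continuous (lineExtension hab f) :=
  continuous_subtype_val.comp (hf.comp continuous_projIcc)

theorem iterate_lineExtension {a b : ℝ} (hab : a ≤ b) (f : Icc a b → Icc a b) (n : ℕ)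
    (x : Icc a b) : (lineExtension hab f)^[n] x = f^[n] x := by
  induction n generalizing x with
  | zero => rfl
  | succ n ih =>
    rw [iterate_succ_apply, iterate_succ_apply, ← ih, lineExtension, projIcc_val]

theorem iterate_lineExtension_mem {a b : ℝ} (hab : a ≤ b) (f : Icc a b → Icc a b) {n : ℕ}
    (hn : 0 < n) (x : ℝ) : (lineExtension hab f)^[n] x ∈ Icc a b := by
  obtain ⟨l, rfl⟩ := Nat.exists_eq_add_of_lt hn
  rw [Nat.zero_add, iterate_succ_apply']
  exact Subtype.coe_prop _

theorem minimalPeriod_lineExtension {a b : ℝ} (hab : a ≤ b) (f : Icc a b → Icc a b)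
    (x : Icc a b) : minimalPeriod (lineExtension hab f) x = minimalPeriod f x := by
  refine minimalPeriod_eq_minimalPeriod_iff.2 fun n => ?_
  rw [IsPeriodicPt, IsFixedPt, iterate_lineExtension, IsPeriodicPt, IsFixedPt, Subtype.ext_iff]

/-- A chaotic family for a power of the extension of `f` gives one for `f` itself. -/
theorem IsChaoticFamily.exists_isScrambledSet {a b : ℝ} (hab : a ≤ b) {f : Icc a b → Icc a b}
    {N : ℕ} (hN : 0 < N) {δ : ℝ} {S : Set ℝ}
    (hS : IsChaoticFamily (lineExtension hab f)^[N] δ S) :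
    ∃ T : Set (Icc a b), IsScrambledSet f δ T ∧ T ⊆ recurrentSet f ∧ MapsTo f^[N] T T ∧
      T ⊆ ⋂ x ∈ T, omegaLimitPt f x ∧
      ∀ L : ℕ, ∃ p ∈ ⋂ x ∈ T, omegaLimitPt f x, p ∈ periodicPts f ∧ L ≤ minimalPeriod f p := by
  have hit : ∀ t (x : Icc a b), ((lineExtension hab f)^[N])^[t] (x : ℝ) = f^[N * t] x := by
    intro t x
    rw [← iterate_mul, iterate_lineExtension]
  have hitm : ∀ t ≥ 1, ∀ x : ℝ, ((lineExtension hab f)^[N])^[t] x ∈ Icc a b := by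
    intro t ht x
    rw [← iterate_mul]
    exact iterate_lineExtension_mem hab f (Nat.mul_pos hN ht) x
  -- A point of `S` is a limit of its own orbit, which lies in `[a, b]` after one step.
  have hmem : ∀ x ∈ S, x ∈ Icc a b := by
    intro x hx
    refine isClosed_Icc.closure_subset (Metric.mem_closure_iff.2 fun ε hε => ?_)
    obtain ⟨t, ht, h⟩ := hS.accumulates x hx x hx (ε / 2) (by linarith) 1
    refine ⟨_, hitm t ht x, ?_⟩
    rw [dist_comm, Real.dist_eq]
    linarith
  have hfreq : ∀ {P : ℝ → ℝ → Prop} (x y : Icc a b), (∀ M, ∃ t ≥ M,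
      P (((lineExtension hab f)^[N])^[t] x) (((lineExtension hab f)^[N])^[t] y)) →
      ∃ᶠ j in atTop, P (f^[j] x) (f^[j] y) := by
    intro P x y h
    refine frequently_atTop_of_mul hN fun M => ?_
    obtain ⟨t, ht, hP⟩ := h M
    rw [hit, hit] at hP
    exact ⟨t, ht, hP⟩
  set T : Set (Icc a b) := {x | (x : ℝ) ∈ S} with hT
  have homega : ∀ y : Icc a b, (∀ x ∈ S, ∀ ε > 0, ∀ M, ∃ t ≥ M,
      |((lineExtension hab f)^[N])^[t] x - y| ≤ ε) → ∀ x ∈ T, y ∈ omegaLimitPt f x :=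
    fun y hy x hx => mem_omegaLimitPt_of_frequently fun ε hε =>
      hfreq (P := fun s _ => |s - y| ≤ ε) x x (hy x hx ε hε)
  have hacc : ∀ y ∈ T, ∀ x ∈ T, y ∈ omegaLimitPt f x := fun y hy =>
    homega y fun x hx => hS.accumulates x hx y hy
  refine ⟨T, ⟨?_, ?_, ?_, ?_⟩, fun x hx => hacc x hx x hx, ?_,
    fun y hy => mem_iInter₂.2 (hacc y hy), fun L => ?_⟩
  · intro hc
    refine hS.not_countable ((hc.image Subtype.val).mono fun x hx => ?_)
    exact ⟨⟨x, hmem x hx⟩, hx, rfl⟩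
  · intro x hx y hy hxy
    exact le_limsup_abs_sub (hfreq (P := fun s t => δ ≤ |s - t|) x y
      (hS.separated x hx y hy (Subtype.coe_ne_coe.2 hxy)))
  · intro x hx y hy _
    exact liminf_abs_sub_eq_zero fun ε hε => hfreq (P := fun s t => |s - t| ≤ ε) x y
      (hS.proximal x hx y hy ε hε)
  · rintro x hx p ⟨L, hL, hp⟩
    refine le_limsup_abs_sub (hfreq (P := fun s t => δ / 2 ≤ |s - t|) x p
      (hS.separated_periodic x hx L hL p ?_))
    rw [hit]
    exact congrArg _ (hp.const_mul N)
  · intro x hx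
    have := hS.mapsTo hx
    rwa [iterate_lineExtension] at this
  · obtain ⟨p, ⟨K, hK, hp⟩, hmin, hpacc⟩ := hS.accumulates_periodic L
    obtain ⟨p, rfl⟩ : ∃ q : Icc a b, (q : ℝ) = p := ⟨⟨p, by rw [← hp]; exact hitm K hK p⟩, rfl⟩
    rw [hit, ← Subtype.ext_iff] at hp
    have hper : p ∈ periodicPts f := ⟨N * K, Nat.mul_pos hN hK, hp⟩
    refine ⟨p, mem_iInter₂.2 (homega p hpacc), hper, ?_⟩
    -- A period of `p` under `f` is also one under `f^[N]`, and those are at least `L`.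
    by_contra! hlt
    refine hmin _ (minimalPeriod_pos_of_mem_periodicPts hper) hlt ?_
    rw [hit]
    exact congrArg _ ((isPeriodicPt_minimalPeriod f p).const_mul N)

end IntervalDynamics

theorem theorem5 {a b : ℝ} (f : Set.Icc a b → Set.Icc a b) (hf : Continuous f)
    (k m : ℕ) (hm : 3 ≤ m) (hodd : Odd m)
    (hper : ∃ c : Set.Icc a b, Function.minimalPeriod f c = 2 ^ k * m)
    (n : ℕ) (hn : n = 2 ∨ m ≤ n) :
    ∃ δ : ℝ, 0 < δ ∧ ∃ S : Set (Set.Icc a b),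
      IsScrambledSet f δ S ∧
      S ⊆ recurrentSet f ∧
      Set.MapsTo (f^[2 ^ k * n]) S S ∧
      S ⊆ ⋂ x ∈ S, omegaLimitPt f x ∧
      ∀ N : ℕ, ∃ p ∈ ⋂ x ∈ S, omegaLimitPt f x,
        p ∈ Function.periodicPts f ∧ N ≤ Function.minimalPeriod f p := by
  obtain ⟨c, hc⟩ := hper
  have hab : a ≤ b := c.2.1.trans c.2.2
  set F := IntervalDynamics.lineExtension hab f
  have hF : Continuous F := IntervalDynamics.continuous_lineExtension hab hf
  have hFc : Function.minimalPeriod F c = 2 ^ k * m := by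
    rw [IntervalDynamics.minimalPeriod_lineExtension, hc]
  -- Iterating `2 ^ k` times divides the period by exactly `2 ^ k`, leaving the odd period `m`.
  have hG : Function.minimalPeriod F^[2 ^ k] c = m := by
    rw [Function.minimalPeriod_iterate_eq_div_gcd (by positivity), hFc, Nat.gcd_comm,
      Nat.gcd_mul_right_right, Nat.mul_div_cancel_left _ (by positivity)]
  obtain ⟨δ, hδ, S, hS⟩ :=
    IntervalDynamics.exists_isChaoticFamily_iterate (hF.iterate _) hm hodd hG hn
  rw [← Function.iterate_mul] at hS
  exact ⟨δ, hδ, hS.exists_isScrambledSet hab (Nat.mul_pos (by positivity) (by omega))⟩
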